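/- Let $\overline{\mathbb G}$ be the category of groups $A$ equipped with two group endomorphisms $\omega_0,\omega_1$ satisfying $\omega_0\omega_1=\omega_1$ and $\omega_1\omega_0=\omega_0$, with the group homomorphisms commuting with $\omega_0,\omega_1$ as morphisms. (Groups are written additively.) An action of $B$ on $A$ in $\overline{\mathbb G}$ is a map $B\times A\to A$ of the form $b\cdot a=s(b)+a-s(b)$ for a split extension $0\to A\to E\to B\to 0$ in $\overline{\mathbb G}$ with section $s:B\to E$. A crossed module in $\overline{\mathbb G}$ is a morphism $\partial:A\to R$ together with an action of $R$ on $A$ in $\overline{\mathbb G}$ such that $\partial(r\cdot a)=r+\partial(a)-r$ and $\partial(a)\cdot a'=a+a'-a$. An actor of $A$ is a crossed module $\partial:A\to R$ in $\overline{\mathbb G}$ such that for every object $C$ of $\overline{\mathbb G}$ and every action of $C$ on $A$ in $\overline{\mathbb G}$ there is a unique morphism $\varphi:C\to R$ with $c\cdot a=\varphi(c)\cdot a$ for all $c\in C$, $a\in A$. For an object $A$ of $\overline{\mathbb G}$, an object $B$ acting on $A$ in $\overline{\mathbb G}$ and $b\in B$, let $\mathbf b$ be the function sending each finite word $w$ in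 $\omega_0,\omega_1$ (the empty word included) to the automorphism $a\mapsto w(b)\cdot a$ of the group $A$. Let $\mathfrak B(A)$ be the closure of the set of all these functions $\mathbf b$ (for all $B$, all actions of $B$ on $A$, and all $b\in B$) under the group operations, given by pointwise composition and inversion of automorphisms, and under the two unary operations $(\omega_iF)(w)=F(w\omega_i)$. Then $\mathfrak B(A)$ is a group with two endomorphisms $\omega_0,\omega_1$, and $F\in\mathfrak B(A)$ acts on $a\in A$ by evaluation at the empty word, $F\cdot a=F(\varnothing)(a)$. A precrossed module of groups consists of groups $T$, $G$, an action of $G$ on $T$ by automorphisms and a homomorphism $\partial:T\to G$ with $\partial(g\cdot t)=g+\partial(t)-g$; morphisms are pairs of group homomorphisms compatible with $\partial$ and with the actions. 1. The functor sending $(T,G,\partial)$ to the semidirect product $T\rtimes G$ with $\omega_0(t,g)=(0,g)$ and $\omega_1(t,g)=(0,\partial(t)+g)$ is an equivalence from the category of precrossed modules of groups to $\overline{\mathbb G}$. 2. For every object $A$ of $\overline{\mathbb G}$, $\mathfrak B(A)$ satisfies $\omega_0\omega_1=\omega_1$ and $\omega_1\omega_0=\omega_0$, and $\mathfrak B(A)$,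 with its action on $A$ and the morphism $d:A\to\mathfrak B(A)$, $d(a)(w)(a')=w(a)+a'-w(a)$, is an actor of $A$. 3. Hence every precrossed module $X$ has an actor: there is a precrossed module $R$ with a morphism $X\to R$ that under the equivalence in 1 becomes an actor in $\overline{\mathbb G}$ for some action; moreover, there is a split extension of precrossed modules with kernel $X$ and quotient $R$ that is terminal in the category of all split extensions of precrossed modules with kernel $X$ (morphisms being the identity on $X$ and commuting with the projections and the sections). -/

import Mathlib

open CategoryTheory

universe u

/-- A group with two additional unary operations `ω 0`, `ω 1` that are group endomorphisms and
satisfy no further identities. Groups are written multiplicatively. -/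
class BiEndGroup (G : Type u) extends Group G where
  ω : Fin 2 → G →* G

/-- The identities `ω₀ω₁ = ω₁` and `ω₁ω₀ = ω₀`. -/
class PrecrossedIdentities (G : Type u) [BiEndGroup G] : Prop where
  ω_zero_ω_one : ∀ x : G, BiEndGroup.ω 0 (BiEndGroup.ω 1 x) = BiEndGroup.ω 1 x
  ω_one_ω_zero : ∀ x : G, BiEndGroup.ω 1 (BiEndGroup.ω 0 x) = BiEndGroup.ω 0 x

/-- The operation `ω_{i₁} ⋯ ω_{iₙ}` for the word `w = [i₁, …, iₙ]`. -/
def wordOp {G : Type u} [BiEndGroup G] (w : List (Fin 2)) (x : G) : G :=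
  w.foldr (fun i y => BiEndGroup.ω i y) x

/-- Group homomorphisms commuting with `ω 0` and `ω 1`. -/
@[ext]
structure BiEndHom (G H : Type u) [BiEndGroup G] [BiEndGroup H] extends G →* H where
  map_ω : ∀ (i : Fin 2) (x : G), toFun (BiEndGroup.ω i x) = BiEndGroup.ω i (toFun x)

instance (G H : Type u) [BiEndGroup G] [BiEndGroup H] : CoeFun (BiEndHom G H) (fun _ => G → H) :=
  ⟨fun f => f.toMonoidHom⟩

/-- The objects of the category of groups with two endomorphisms satisfying `ω₀ω₁ = ω₁` and
`ω₁ω₀ = ω₀`. -/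
structure GBar : Type (u + 1) where
  carrier : Type u
  [str : BiEndGroup carrier]
  [ids : PrecrossedIdentities carrier]

namespace GBar

instance : CoeSort GBar.{u} (Type u) := ⟨GBar.carrier⟩

instance (A : GBar.{u}) : BiEndGroup A := A.str

instance (A : GBar.{u}) : PrecrossedIdentities A := A.ids

instance : Category GBar.{u} where
  Hom A B := BiEndHom A B
  id A := { MonoidHom.id A with map_ω := fun _ _ => rfl }
  comp {A B C} f g :=
    { g.toMonoidHom.comp f.toMonoidHom with
      map_ω := fun i x => (congrArg g.toFun (f.map_ω i x)).trans (g.map_ω i (f.toFun x)) }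

end GBar

/-- `1 → A → E → B → 1`, with `s : B → E`, is a split extension of `B` by `A`. -/
structure IsSplitExtension {A E B : GBar.{u}} (i : BiEndHom A E) (p : BiEndHom E B)
    (s : BiEndHom B E) : Prop where
  injective : Function.Injective i
  exact : ∀ x : E, p x = 1 ↔ ∃ a : A, i a = x
  surjective : Function.Surjective p
  section_eq : ∀ b : B, p (s b) = b

/-- `act : B → A → A` is a derived action: it is induced by a split extension
of `B` by `A` in the category `GBar` through `b · a = s(b) a s(b)⁻¹`. -/
def IsDerivedAction {B A : GBar.{u}} (act : B → A → A) : Prop :=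
  ∃ (E : GBar.{u}) (i : BiEndHom A E) (p : BiEndHom E B) (s : BiEndHom B E),
    IsSplitExtension i p s ∧ ∀ (b : B) (a : A), i (act b a) = s b * i a * (s b)⁻¹

/-- A crossed module `∂ : A → R` in the category `GBar`, for the action `act` of `R` on `A`. -/
structure IsCrossedModule {A R : GBar.{u}} (act : R → A → A) (d : BiEndHom A R) : Prop where
  derived : IsDerivedAction act
  equivariant : ∀ (r : R) (a : A), d (act r a) = r * d a * r⁻¹
  peiffer : ∀ a a' : A, act (d a) a' = a * a' * a⁻¹

/-- `d : A → R`, with the action `act` of `R` on `A`, is an actor of `A` in the category `GBar`. -/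
structure IsActor {A R : GBar.{u}} (act : R → A → A) (d : BiEndHom A R) : Prop where
  crossed : IsCrossedModule act d
  universal : ∀ (C : GBar.{u}) (f : C → A → A), IsDerivedAction f →
    ∃! φ : BiEndHom C R, ∀ (c : C) (a : A), f c a = act (φ c) a

section Construction

variable (A : GBar.{u})

/-- The functions `w ↦ ((w b) · -)`, for `w` a word in `ω₀, ω₁` and `b` an element of some object
`B` of `GBar` with a derived action on `A`. Recording the dot action of `w b` for every word `w`
builds in the identification of `b` and `b'` when `w b · a = w b' · a` for all `w` and `a`. -/
def derivedElements : Set (List (Fin 2) → MulAut A) :=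
  {F | ∃ (B : GBar.{u}) (act : B → A → A) (b : B), IsDerivedAction act ∧
    ∀ (w : List (Fin 2)) (a : A), F w a = act (wordOp w b) a}

/-- The unary operation `ω i` on functions: `(w (ω i F)) · a = ((w ω i) F) · a`. -/
def shiftHom (i : Fin 2) : (List (Fin 2) → MulAut A) →* (List (Fin 2) → MulAut A) where
  toFun F w := F (w ++ [i])
  map_one' := rfl
  map_mul' _ _ := rfl

/-- The closure of `derivedElements A` under the group operations (pointwise composition and
inversion, so `(F F') · a = F · (F' · a)`) and the two unary operations. -/
def frakBSubgroup : Subgroup (List (Fin 2) → MulAut A) :=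
  sInf {H | derivedElements A ⊆ H ∧ ∀ (i : Fin 2), ∀ F ∈ H, shiftHom A i F ∈ H}

/-- The object `𝔅(A)`, a group with two endomorphisms. -/
def FrakB : Type u := frakBSubgroup A

theorem shiftHom_mem (i : Fin 2) {F : List (Fin 2) → MulAut A} (hF : F ∈ frakBSubgroup A) :
    shiftHom A i F ∈ frakBSubgroup A := by
  refine Subgroup.mem_sInf.2 fun H hH => hH.2 i F ?_
  exact Subgroup.mem_sInf.1 hF H hH

instance : BiEndGroup (FrakB A) where
  toGroup := inferInstanceAs (Group (frakBSubgroup A))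
  ω i := ((shiftHom A i).comp (frakBSubgroup A).subtype).codRestrict (frakBSubgroup A)
    (fun F => shiftHom_mem A i F.2)

/-- The action of `𝔅(A)` on `A`: evaluation at the empty word. -/
def frakBAct (F : FrakB A) (a : A) : A := F.1 [] a

end Construction

/-- A precrossed module of groups: `∂ : T → G` with an action of `G` on `T` by
automorphisms such that `∂ (g • t) = g ∂(t) g⁻¹`. -/
structure PreXMod : Type (u + 1) where
  T : Type u
  G : Type u
  [groupT : Group T]
  [groupG : Group G]
  [action : MulDistribMulAction G T]
  bd : T →* G
  bd_smul : ∀ (g : G) (t : T), bd (g • t) = g * bd t * g⁻¹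

namespace PreXMod

attribute [instance] groupT groupG action

@[ext]
structure Hom (X Y : PreXMod.{u}) where
  top : X.T →* Y.T
  base : X.G →* Y.G
  bd_top : ∀ t : X.T, Y.bd (top t) = base (X.bd t)
  top_smul : ∀ (g : X.G) (t : X.T), top (g • t) = base g • top t

instance : Category PreXMod.{u} where
  Hom X Y := Hom X Y
  id X := ⟨MonoidHom.id _, MonoidHom.id _, fun _ => rfl, fun _ _ => rfl⟩
  comp f g := ⟨g.top.comp f.top, g.base.comp f.base,
    fun t => by simp [g.bd_top, f.bd_top], fun a t => by simp [f.top_smul, g.top_smul]⟩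

/-- The semidirect product `T ⋊ G`. -/
abbrev Semi (X : PreXMod.{u}) : Type u := X.T ⋊[MulDistribMulAction.toMulAut X.G X.T] X.G

/-- `(t, g) ↦ ∂(t) g`. -/
def target (X : PreXMod.{u}) : X.Semi →* X.G where
  toFun x := X.bd x.left * x.right
  map_one' := by simp
  map_mul' x y := by simp [X.bd_smul, mul_assoc]

/-- `ω₀ (t, g) = (1, g)` and `ω₁ (t, g) = (1, ∂(t) g)`. -/
instance (X : PreXMod.{u}) : BiEndGroup X.Semi where
  ω := ![SemidirectProduct.inr.comp SemidirectProduct.rightHom,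
    SemidirectProduct.inr.comp X.target]

instance (X : PreXMod.{u}) : PrecrossedIdentities X.Semi where
  ω_zero_ω_one x := by simp [BiEndGroup.ω]
  ω_one_ω_zero x := by simp [BiEndGroup.ω, target]

/-- The functor `(T, G, ∂) ↦ (T ⋊ G, ω₀, ω₁)`. -/
def toGBar : PreXMod.{u} ⥤ GBar.{u} where
  obj X := ⟨X.Semi⟩
  map {X Y} f :=
    { SemidirectProduct.map f.top f.base
        (fun g => MonoidHom.ext (fun t => by simpa using f.top_smul g t)) with
      map_ω := by
        intro i x
        fin_cases i
        · ext <;> simp [BiEndGroup.ω]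
        · ext <;> simp [BiEndGroup.ω, target, f.bd_top] }
  map_id X := rfl
  map_comp f g := rfl

/-- `1 → X → E → B → 1`, with `s : B → E`, is a split extension of precrossed modules. -/
structure IsSplitExt {X E B : PreXMod.{u}} (k : X ⟶ E) (p : E ⟶ B) (s : B ⟶ E) : Prop where
  injective_top : Function.Injective (Hom.top k)
  injective_base : Function.Injective (Hom.base k)
  exact_top : (Hom.top p).ker = (Hom.top k).range
  exact_base : (Hom.base p).ker = (Hom.base k).range
  section_eq : s ≫ p = 𝟙 B

/-- The split extension `1 → X → E → R → 1` is universal among the split extensions with kernel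
`X`, i.e. terminal in the category of these split extensions: every action of a precrossed
module `B` on `X` is obtained from that of `R` along a unique morphism `B → R`. -/
structure IsUniversalSplitExt {X E R : PreXMod.{u}} (k : X ⟶ E) (p : E ⟶ R) (s : R ⟶ E) :
    Prop where
  split : IsSplitExt k p s
  universal : ∀ (E' B : PreXMod.{u}) (k' : X ⟶ E') (p' : E' ⟶ B) (s' : B ⟶ E'),
    IsSplitExt k' p' s' →
    ∃! γφ : (E' ⟶ E) × (B ⟶ R), k' ≫ γφ.1 = k ∧ γφ.1 ≫ p = p' ≫ γφ.2 ∧ s' ≫ γφ.1 = γφ.2 ≫ s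

end PreXMod

/-! ### Derived actions as compatible actions by automorphisms. -/

section Actions

variable {A B C : GBar.{u}}

/-! Part 1: `ω 0` is an idempotent endomorphism, so `A` splits as `ker ω₀ ⋊ im ω₀`, and `ω 1`, which
fixes `im ω₀`, restricts on `ker ω₀` to a boundary map. Morphisms preserve both factors, hence
`toGBar` is fully faithful, and `counitHom` gives essential surjectivity.

Part 2: a derived action is the same as an action by automorphisms with `ωᵢ(b · a) = ωᵢ(b) · ωᵢ(a)`,
since such an action has a componentwise semidirect product. The identities give `ωᵢωⱼ = ωⱼ`, so a
nonempty word acts through its last letter. This property of the generating functions, and their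
compatibility with `ω`, survive products, inverses and shifts, so they hold on all of `𝔅(A)`
(`frakBSubgroup_le`). Hence `𝔅(A)` satisfies the identities and acts compatibly on `A`. An action of
`C` is classified by `c ↦ (w ↦ w(c) · -)`, whose values are generators; it is the only choice
because `F(w)` is the action of `w(F)` (`FrakB.wordOp_val`). Conjugation is classified by `d`.

Part 3: actors pass through the equivalence. A split extension amounts to its action, so the
universal action of an actor yields a terminal split extension (`IsActor.existsUnique_hom`). -/

theorem BiEndGroup.hom_ω (f : BiEndHom A B) (i : Fin 2) (x : A) :
    f (BiEndGroup.ω i x) = BiEndGroup.ω i (f x) :=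
  f.map_ω i x

theorem map_wordOp (f : BiEndHom A B) (w : List (Fin 2)) (x : A) :
    f (wordOp w x) = wordOp w (f x) := by
  induction w with
  | nil => rfl
  | cons i w ih =>
    exact (f.map_ω i _).trans (congrArg _ ih)

theorem wordOp_one (w : List (Fin 2)) : wordOp w (1 : A) = 1 := by
  induction w with
  | nil => rfl
  | cons i w ih => exact (congrArg _ ih).trans (map_one _)

theorem wordOp_mul (w : List (Fin 2)) (x y : A) :
    wordOp w (x * y) = wordOp w x * wordOp w y := by
  induction w with
  | nil => rfl
  | cons i w ih => exact (congrArg _ ih).trans (map_mul _ _ _)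

theorem wordOp_append (w w' : List (Fin 2)) (x : A) :
    wordOp (w ++ w') x = wordOp w (wordOp w' x) := by
  simp [wordOp]

/-- `ωᵢωⱼ = ωⱼ` for all `i` and `j`. -/
theorem ω_ω (i j : Fin 2) (x : A) :
    BiEndGroup.ω i (BiEndGroup.ω j x) = BiEndGroup.ω j x := by
  have h01 := PrecrossedIdentities.ω_zero_ω_one (G := A)
  have h10 := PrecrossedIdentities.ω_one_ω_zero (G := A)
  fin_cases i <;> fin_cases j
  · change BiEndGroup.ω 0 (BiEndGroup.ω 0 x) = BiEndGroup.ω 0 x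
    simpa only [h10] using h01 (BiEndGroup.ω 0 x)
  · exact h01 x
  · exact h10 x
  · change BiEndGroup.ω 1 (BiEndGroup.ω 1 x) = BiEndGroup.ω 1 x
    simpa only [h01] using h10 (BiEndGroup.ω 1 x)

theorem wordOp_ω (w : List (Fin 2)) (j : Fin 2) (x : A) :
    wordOp w (BiEndGroup.ω j x) = BiEndGroup.ω j x := by
  induction w with
  | nil => rfl
  | cons i w ih => exact (congrArg _ ih).trans (ω_ω i j x)

/-- An action by automorphisms compatible with the operations `ω i`. -/
structure IsCompatibleAction (act : B → A → A) : Prop where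
  one_act : ∀ a, act 1 a = a
  mul_act : ∀ b b' a, act (b * b') a = act b (act b' a)
  act_mul : ∀ b a a', act b (a * a') = act b a * act b a'
  ω_act : ∀ i b a, BiEndGroup.ω i (act b a) = act (BiEndGroup.ω i b) (BiEndGroup.ω i a)

/-- The homomorphism to the automorphism group given by a compatible action. -/
def IsCompatibleAction.toMulAut {act : B → A → A} (h : IsCompatibleAction act) :
    B →* MulAut A where
  toFun b :=
    { toFun := act b
      invFun := act b⁻¹
      left_inv := fun a => by rw [← h.mul_act, inv_mul_cancel, h.one_act]
      right_inv := fun a => by rw [← h.mul_act, mul_inv_cancel, h.one_act]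
      map_mul' := h.act_mul b }
  map_one' := MulEquiv.ext h.one_act
  map_mul' b b' := MulEquiv.ext (h.mul_act b b')

@[simp]
theorem IsCompatibleAction.toMulAut_apply {act : B → A → A} (h : IsCompatibleAction act)
    (b : B) (a : A) : h.toMulAut b a = act b a := rfl

theorem IsCompatibleAction.comp {act : B → A → A} (h : IsCompatibleAction act)
    (f : BiEndHom C B) : IsCompatibleAction fun c a => act (f c) a where
  one_act a := by rw [map_one, h.one_act]
  mul_act c c' a := by rw [map_mul, h.mul_act]
  act_mul c := h.act_mul _
  ω_act i c a := by rw [h.ω_act, BiEndGroup.hom_ω]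

/-- The operations `ω i` on the semidirect product are defined componentwise. -/
abbrev IsCompatibleAction.semidirectStr {act : B → A → A} (h : IsCompatibleAction act) :
    BiEndGroup (A ⋊[h.toMulAut] B) where
  toGroup := inferInstance
  ω i := SemidirectProduct.map (BiEndGroup.ω i) (BiEndGroup.ω i)
    (fun b => MonoidHom.ext fun a => h.ω_act i b a)

/-- The semidirect product with respect to a compatible action. -/
def IsCompatibleAction.semidirect {act : B → A → A} (h : IsCompatibleAction act) : GBar.{u} :=
  letI := h.semidirectStr
  { carrier := A ⋊[h.toMulAut] B
    ids :=
      { ω_zero_ω_one := fun x => SemidirectProduct.ext (ω_ω 0 1 x.left) (ω_ω 0 1 x.right)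
        ω_one_ω_zero := fun x => SemidirectProduct.ext (ω_ω 1 0 x.left) (ω_ω 1 0 x.right) } }

/-- The kernel inclusion of the semidirect product. -/
def IsCompatibleAction.inl {act : B → A → A} (h : IsCompatibleAction act) :
    BiEndHom A h.semidirect where
  toMonoidHom := (SemidirectProduct.inl : A →* A ⋊[h.toMulAut] B)
  map_ω i _ := SemidirectProduct.ext rfl (map_one (BiEndGroup.ω i : B →* B)).symm

/-- The section of the semidirect product. -/
def IsCompatibleAction.inr {act : B → A → A} (h : IsCompatibleAction act) :
    BiEndHom B h.semidirect where
  toMonoidHom := (SemidirectProduct.inr : B →* A ⋊[h.toMulAut] B)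
  map_ω i _ := SemidirectProduct.ext (map_one (BiEndGroup.ω i : A →* A)).symm rfl

/-- The projection of the semidirect product. -/
def IsCompatibleAction.proj {act : B → A → A} (h : IsCompatibleAction act) :
    BiEndHom h.semidirect B where
  toMonoidHom := (SemidirectProduct.rightHom : A ⋊[h.toMulAut] B →* B)
  map_ω _ _ := rfl

theorem IsCompatibleAction.isSplitExtension {act : B → A → A} (h : IsCompatibleAction act) :
    IsSplitExtension h.inl h.proj h.inr where
  injective := SemidirectProduct.inl_injective (φ := h.toMulAut)
  exact x := by
    constructor
    · intro hx
      exact ⟨SemidirectProduct.left x, SemidirectProduct.ext rfl hx.symm⟩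
    · rintro ⟨a, rfl⟩
      rfl
  surjective := SemidirectProduct.rightHom_surjective (φ := h.toMulAut)
  section_eq _ := rfl

theorem IsCompatibleAction.inl_act {act : B → A → A} (h : IsCompatibleAction act)
    (b : B) (a : A) : h.inl (act b a) = h.inr b * h.inl a * (h.inr b)⁻¹ :=
  (SemidirectProduct.inl_aut (φ := h.toMulAut) b a).trans
    (congrArg _ (map_inv (SemidirectProduct.inr (φ := h.toMulAut)) b))

theorem IsCompatibleAction.isDerivedAction {act : B → A → A} (h : IsCompatibleAction act) :
    IsDerivedAction act :=
  ⟨h.semidirect, h.inl, h.proj, h.inr, h.isSplitExtension, h.inl_act⟩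

/-- Inside the extension the action is conjugation by the section, so each law can be checked after
the injective kernel inclusion. -/
theorem IsDerivedAction.isCompatibleAction {act : B → A → A} (h : IsDerivedAction act) :
    IsCompatibleAction act := by
  obtain ⟨E, i, p, s, hs, hact⟩ := h
  refine ⟨fun a => hs.injective ?_, fun b b' a => hs.injective ?_, fun b a a' => hs.injective ?_,
    fun j b a => hs.injective ?_⟩
  · rw [hact, map_one]; group
  · rw [hact, hact, hact, map_mul]; group
  · rw [hact, map_mul, map_mul, hact, hact]; group
  · rw [BiEndGroup.hom_ω, hact, hact, BiEndGroup.hom_ω, BiEndGroup.hom_ω]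
    simp only [map_mul, map_inv]

/-- Every split extension determines a compatible action of the quotient on the kernel. -/
theorem IsSplitExtension.exists_action {E : GBar.{u}} {i : BiEndHom A E} {p : BiEndHom E B}
    {s : BiEndHom B E} (h : IsSplitExtension i p s) :
    ∃ act : B → A → A, ∀ b a, i (act b a) = s b * i a * (s b)⁻¹ := by
  have key : ∀ b a, ∃ a', i a' = s b * i a * (s b)⁻¹ := fun b a => by
    rw [← h.exact]
    simp only [map_mul, map_inv, (h.exact (i a)).2 ⟨a, rfl⟩]
    group
  choose act hact using key
  exact ⟨act, hact⟩

end Actions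

/-! ### The object `𝔅(A)` and its actor property. -/

section Actor

variable (A : GBar.{u})

/-- The functions `F` on words whose values depend only on the last letter and which satisfy
`ωᵢ (w F · a) = (ωᵢ w) F · ωᵢ a`. -/
def compatibleSubgroup : Subgroup (List (Fin 2) → MulAut A) where
  carrier := {F | (∀ w j, F (w ++ [j]) = F [j]) ∧
    ∀ i w a, BiEndGroup.ω i (F w a) = F (i :: w) (BiEndGroup.ω i a)}
  one_mem' := ⟨fun _ _ => rfl, fun _ _ _ => rfl⟩
  mul_mem' {F F'} hF hF' :=
    ⟨fun w j => by simp only [Pi.mul_apply, hF.1, hF'.1],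
      fun i w a => by simp only [Pi.mul_apply, MulAut.mul_apply, hF.2, hF'.2]⟩
  inv_mem' {F} hF :=
    ⟨fun w j => by simp only [Pi.inv_apply, hF.1], fun i w a => by
      simp only [Pi.inv_apply]
      apply (F (i :: w)).injective
      rw [← hF.2, MulAut.apply_inv_self, MulAut.apply_inv_self]⟩

/-- By minimality of the closure, it suffices that the larger subgroup contains the generators and
is stable under shifts. -/
theorem frakBSubgroup_le : frakBSubgroup A ≤ compatibleSubgroup A := by
  refine sInf_le ⟨?_, ?_⟩
  · rintro F ⟨B, act, b, hact, hF⟩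
    have h := hact.isCompatibleAction
    refine ⟨fun w j => MulEquiv.ext fun a => ?_, fun i w a => ?_⟩
    · rw [hF, hF, wordOp_append]
      exact congrArg (act · a) (wordOp_ω w j b)
    · rw [hF, hF, h.ω_act]
      rfl
  · intro i F hF
    refine ⟨fun w j => ?_, fun j w a => hF.2 j (w ++ [i]) a⟩
    change F (w ++ [j] ++ [i]) = F ([j] ++ [i])
    rw [hF.1, hF.1]

theorem derivedElements_subset : derivedElements A ⊆ frakBSubgroup A := fun _ hF =>
  Subgroup.mem_sInf.2 fun _ hH => hH.1 hF

variable {A}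

theorem FrakB.apply_append (F : FrakB A) (w : List (Fin 2)) (j : Fin 2) :
    F.1 (w ++ [j]) = F.1 [j] :=
  (frakBSubgroup_le A F.2).1 w j

theorem FrakB.ω_apply (F : FrakB A) (i : Fin 2) (w : List (Fin 2)) (a : A) :
    BiEndGroup.ω i (F.1 w a) = F.1 (i :: w) (BiEndGroup.ω i a) :=
  (frakBSubgroup_le A F.2).2 i w a

/-- Iterating compatibility pushes a whole word through the action; this is what makes `d`
equivariant at every word. -/
theorem FrakB.wordOp_apply (F : FrakB A) (w : List (Fin 2)) (a : A) :
    wordOp w (F.1 [] a) = F.1 w (wordOp w a) := by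
  induction w with
  | nil => rfl
  | cons i w ih => exact (congrArg _ ih).trans (F.ω_apply i w _)

/-- At `w' = []` this recovers every value of `F` from the actions of the elements `w(F)`, whence
uniqueness of classifying morphisms. -/
theorem FrakB.wordOp_val (F : FrakB A) (w w' : List (Fin 2)) :
    (wordOp w F).1 w' = F.1 (w' ++ w) := by
  induction w generalizing w' with
  | nil => rw [List.append_nil]; rfl
  | cons i w ih =>
    change (wordOp w F).1 (w' ++ [i]) = _
    rw [ih, List.append_assoc]
    rfl

variable (A)

theorem FrakB.precrossedIdentities : PrecrossedIdentities (FrakB A) where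
  ω_zero_ω_one F := Subtype.ext <| funext fun w =>
    -- Shifts append on the right, so `ω₀ω₁F` at `w` is `F` at `w ++ [0] ++ [1]`, with the same last
    -- letter as `w ++ [1]`.
    (F.apply_append (w ++ [0]) 1).trans (F.apply_append w 1).symm
  ω_one_ω_zero F := Subtype.ext <| funext fun w =>
    (F.apply_append (w ++ [1]) 0).trans (F.apply_append w 0).symm

instance : PrecrossedIdentities (FrakB A) := FrakB.precrossedIdentities A

/-- `𝔅(A)` as an object of `GBar`. -/
abbrev frakB : GBar.{u} := GBar.mk (FrakB A)

theorem frakBAct_isCompatibleAction :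
    IsCompatibleAction (A := A) (B := frakB A) (frakBAct A) where
  one_act _ := rfl
  mul_act _ _ _ := rfl
  act_mul F a a' := map_mul (F.1 []) a a'
  ω_act i F a := F.ω_apply i [] a

variable {A}

/-- The morphism to `𝔅(A)` classifying a compatible action. -/
def IsCompatibleAction.toFrakB {C : GBar.{u}} {f : C → A → A} (h : IsCompatibleAction f) :
    BiEndHom C (frakB A) where
  toFun c := ⟨fun w => h.toMulAut (wordOp w c),
    derivedElements_subset A ⟨C, f, c, h.isDerivedAction, fun _ _ => rfl⟩⟩
  map_one' := Subtype.ext <| funext fun w => by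
    change h.toMulAut (wordOp w 1) = 1
    rw [wordOp_one, map_one]
  map_mul' x y := Subtype.ext <| funext fun w => by
    change h.toMulAut (wordOp w (x * y)) = h.toMulAut (wordOp w x) * h.toMulAut (wordOp w y)
    rw [wordOp_mul, map_mul]
  map_ω i x := Subtype.ext <| funext fun w => by
    change h.toMulAut (wordOp w (wordOp [i] x)) = h.toMulAut (wordOp (w ++ [i]) x)
    rw [wordOp_append]

variable (A)

theorem conj_isCompatibleAction :
    IsCompatibleAction (A := A) (B := A) fun a a' => a * a' * a⁻¹ where
  one_act a := by group
  mul_act b b' a := by group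
  act_mul b a a' := by group
  ω_act i b a := by simp only [map_mul, map_inv]

theorem frakB_isActor : IsActor (A := A) (R := frakB A) (frakBAct A)
    (conj_isCompatibleAction A).toFrakB where
  crossed :=
    { derived := (frakBAct_isCompatibleAction A).isDerivedAction
      equivariant := fun r a => Subtype.ext <| funext fun w => MulEquiv.ext fun a' => by
        change wordOp w (r.1 [] a) * a' * (wordOp w (r.1 [] a))⁻¹ =
          r.1 w (wordOp w a * (r.1 w)⁻¹ a' * (wordOp w a)⁻¹)
        rw [FrakB.wordOp_apply, map_mul, map_mul, map_inv, MulAut.apply_inv_self]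
      peiffer := fun _ _ => rfl }
  universal C f hf := by
    refine ⟨hf.isCompatibleAction.toFrakB, fun _ _ => rfl, fun φ hφ => ?_⟩
    refine BiEndHom.ext <| funext fun c => Subtype.ext <| funext fun w =>
      MulEquiv.ext fun a => ?_
    -- The hypothesis on `φ` concerns only the empty word; it is applied to `wordOp w c` instead of
    -- `c`.
    change (φ c).1 w a = f (wordOp w c) a
    rw [hφ, map_wordOp]
    exact (DFunLike.congr_fun (FrakB.wordOp_val (φ c) w []) a).symm

end Actor

/-! ### Isomorphisms in `GBar`. -/

namespace GBar

variable {A B C : GBar.{u}}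

theorem hom_ext {f g : A ⟶ B}
    (h : ∀ x, BiEndHom.toMonoidHom f x = BiEndHom.toMonoidHom g x) : f = g :=
  BiEndHom.ext (funext h)

theorem comp_apply (f : A ⟶ B) (g : B ⟶ C) (x : A) :
    BiEndHom.toMonoidHom (f ≫ g) x = BiEndHom.toMonoidHom g (BiEndHom.toMonoidHom f x) := rfl

theorem congr_hom {f g : A ⟶ B} (h : f = g) (x : A) :
    BiEndHom.toMonoidHom f x = BiEndHom.toMonoidHom g x := by rw [h]

theorem hom_inv_apply (e : A ≅ B) (x : A) :
    BiEndHom.toMonoidHom e.inv (BiEndHom.toMonoidHom e.hom x) = x :=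
  congr_hom e.hom_inv_id x

theorem inv_hom_apply (e : A ≅ B) (x : B) :
    BiEndHom.toMonoidHom e.hom (BiEndHom.toMonoidHom e.inv x) = x :=
  congr_hom e.inv_hom_id x

/-- A bijective morphism is an isomorphism. -/
noncomputable def isoOfBijective (f : BiEndHom A B) (hf : Function.Bijective f) : A ≅ B :=
  let e := MulEquiv.ofBijective f.toMonoidHom hf
  { hom := f
    inv :=
      { e.symm.toMonoidHom with
        map_ω := fun i x => e.injective <| by
          change e (e.symm _) = f (BiEndGroup.ω i (e.symm x))
          rw [e.apply_symm_apply, BiEndGroup.hom_ω]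
          exact congrArg _ (e.apply_symm_apply x).symm }
    hom_inv_id := hom_ext fun x => e.symm_apply_apply x
    inv_hom_id := hom_ext fun x => e.apply_symm_apply x }

end GBar

/-! ### The equivalence between precrossed modules and `GBar`. -/

namespace PreXMod

theorem ω_zero_apply (X : PreXMod.{u}) (x : X.Semi) :
    BiEndGroup.ω 0 x = SemidirectProduct.inr x.right := rfl

theorem ω_one_apply (X : PreXMod.{u}) (x : X.Semi) :
    BiEndGroup.ω 1 x = SemidirectProduct.inr (X.bd x.left * x.right) := rfl

section Full

variable {X Y : PreXMod.{u}} (φ : BiEndHom (toGBar.obj X) (toGBar.obj Y))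

/-- The homomorphism of semidirect products underlying a morphism of `GBar`. -/
abbrev semiHom : X.Semi →* Y.Semi := φ.toMonoidHom

theorem semiHom_ω (i : Fin 2) (x : X.Semi) :
    semiHom φ (BiEndGroup.ω i x) = BiEndGroup.ω i (semiHom φ x) := φ.map_ω i x

/-- The factor `T` is the kernel of `ω 0`, which any morphism preserves. -/
theorem semiHom_inl (t : X.T) :
    semiHom φ (SemidirectProduct.inl t) =
      SemidirectProduct.inl (semiHom φ (SemidirectProduct.inl t)).left := by
  refine SemidirectProduct.ext (by simp) ?_
  have h := semiHom_ω φ 0 (SemidirectProduct.inl t)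
  rw [ω_zero_apply, ω_zero_apply, SemidirectProduct.right_inl, map_one, map_one] at h
  simpa using (congrArg SemidirectProduct.right h).symm

/-- The factor `G` consists of the fixed points of `ω 0`, which any morphism preserves. -/
theorem semiHom_inr (g : X.G) :
    semiHom φ (SemidirectProduct.inr g) =
      SemidirectProduct.inr (semiHom φ (SemidirectProduct.inr g)).right := by
  have h := semiHom_ω φ 0 (SemidirectProduct.inr g)
  rwa [ω_zero_apply, ω_zero_apply, SemidirectProduct.right_inr] at h

/-- The morphism of precrossed modules underlying a morphism of semidirect products. -/
def ofSemiHom : Hom X Y where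
  top :=
    { toFun := fun t => (semiHom φ (SemidirectProduct.inl t)).left
      map_one' := by simp
      map_mul' := fun t t' => by
        rw [map_mul, map_mul, SemidirectProduct.mul_left, semiHom_inl φ t,
          SemidirectProduct.right_inl, map_one]
        rfl }
  base := SemidirectProduct.rightHom.comp ((semiHom φ).comp SemidirectProduct.inr)
  bd_top t := by
    have h := semiHom_ω φ 1 (SemidirectProduct.inl t)
    rw [ω_one_apply, ω_one_apply, semiHom_inl φ t] at h
    simpa using (congrArg SemidirectProduct.right h).symm
  top_smul g t := by
    have h : semiHom φ (SemidirectProduct.inl (g • t)) = SemidirectProduct.inl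
        ((semiHom φ (SemidirectProduct.inr g)).right •
          (semiHom φ (SemidirectProduct.inl t)).left) := by
      -- In both semidirect products the action is conjugation, which a homomorphism respects.
      have h1 := SemidirectProduct.inl_aut (φ := MulDistribMulAction.toMulAut X.G X.T) g t
      have h2 := SemidirectProduct.inl_aut (φ := MulDistribMulAction.toMulAut Y.G Y.T)
        (semiHom φ (SemidirectProduct.inr g)).right (semiHom φ (SemidirectProduct.inl t)).left
      rw [MulDistribMulAction.toMulAut_apply, MulDistribMulAction.toMulEquiv_apply] at h1 h2
      rw [h1, h2, map_mul, map_mul, map_inv, ← semiHom_inl, map_inv, map_inv, ← semiHom_inr]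
    exact congrArg SemidirectProduct.left h

theorem toGBar_map_ofSemiHom : toGBar.map (ofSemiHom φ) = φ := by
  refine GBar.hom_ext fun (x : X.Semi) => ?_
  change _ = semiHom φ x
  conv_rhs => rw [← SemidirectProduct.inl_left_mul_inr_right x, map_mul, semiHom_inl, semiHom_inr]
  exact SemidirectProduct.mk_eq_inl_mul_inr _ _

end Full

instance : toGBar.{u}.Full where
  map_surjective φ := ⟨ofSemiHom φ, toGBar_map_ofSemiHom φ⟩

instance : toGBar.{u}.Faithful where
  map_injective {X Y f g} h := by
    refine Hom.ext (MonoidHom.ext fun t => ?_) (MonoidHom.ext fun x => ?_)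
    · exact congrArg SemidirectProduct.left
        (GBar.congr_hom h (SemidirectProduct.inl t : X.Semi))
    · exact congrArg SemidirectProduct.right
        (GBar.congr_hom h (SemidirectProduct.inr x : X.Semi))

section EssSurj

variable (A : GBar.{u})

/-- The image of `ω i`, for either `i`. -/
abbrev baseGroup : Subgroup A := (BiEndGroup.ω 0 : A →* A).range

theorem ω_eq_self (i : Fin 2) (g : baseGroup A) : BiEndGroup.ω i (g : A) = g := by
  obtain ⟨_, x, rfl⟩ := g
  exact ω_ω i 0 x

/-- The kernel of `ω 0`. -/
abbrev topGroup : Subgroup A := (BiEndGroup.ω 0 : A →* A).ker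

/-- The conjugation action of the image of `ω 0` on its kernel. -/
abbrev conjAction : MulDistribMulAction (baseGroup A) (topGroup A) where
  smul g t := ⟨g * t * (g : A)⁻¹, (inferInstance : (topGroup A).Normal).conj_mem _ t.2 _⟩
  one_smul t := Subtype.ext (by change (1 : A) * t * (1 : A)⁻¹ = t; group)
  mul_smul g g' t := Subtype.ext (by
    change (g * g' : A) * t * (g * g' : A)⁻¹ = g * (g' * t * (g' : A)⁻¹) * (g : A)⁻¹; group)
  smul_one g := Subtype.ext (by change (g : A) * 1 * (g : A)⁻¹ = 1; group)
  smul_mul g t t' := Subtype.ext (by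
    change (g : A) * (t * t') * (g : A)⁻¹ = g * t * (g : A)⁻¹ * (g * t' * (g : A)⁻¹); group)

/-- The precrossed module `ω₁ : ker ω₀ → im ω₀`. -/
def ofGBar : PreXMod.{u} :=
  letI := conjAction A
  { T := topGroup A
    G := baseGroup A
    bd := ((BiEndGroup.ω 1).comp (topGroup A).subtype).codRestrict (baseGroup A)
      (fun t => ⟨_, ω_ω 0 1 (t : A)⟩)
    bd_smul := fun g t => Subtype.ext (by
      change BiEndGroup.ω 1 ((g : A) * t * (g : A)⁻¹) = g * BiEndGroup.ω 1 (t : A) * (g : A)⁻¹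
      rw [map_mul, map_mul, map_inv, ω_eq_self]) }

/-- The comparison morphism `(t, g) ↦ t g`. -/
def counitHom : BiEndHom (toGBar.obj (ofGBar A)) A where
  toMonoidHom := SemidirectProduct.lift (topGroup A).subtype (baseGroup A).subtype
    (fun g => MonoidHom.ext fun t => rfl : ∀ g : (ofGBar A).G, _)
  map_ω i x := by
    obtain ⟨(t : topGroup A), (g : baseGroup A)⟩ := x
    have h0 : BiEndGroup.ω 0 (t : A) = 1 := t.2
    fin_cases i
    · change (1 : A) * g = BiEndGroup.ω 0 ((t : A) * g)
      rw [map_mul, h0, ω_eq_self]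
    · change (1 : A) * (BiEndGroup.ω 1 (t : A) * g) = BiEndGroup.ω 1 ((t : A) * g)
      rw [map_mul, one_mul, ω_eq_self]

theorem counitHom_bijective : Function.Bijective (counitHom A) := by
  constructor
  · refine (injective_iff_map_eq_one _).2 ?_
    rintro ⟨(t : topGroup A), (g : baseGroup A)⟩ (hx : (t : A) * g = 1)
    have h0 : BiEndGroup.ω 0 (t : A) = 1 := t.2
    have hg : (g : A) = 1 := by
      have := congrArg (BiEndGroup.ω 0) hx
      rwa [map_mul, h0, ω_eq_self, one_mul, map_one] at this
    rw [hg, mul_one] at hx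
    exact SemidirectProduct.ext (Subtype.ext hx) (Subtype.ext hg)
  · intro a
    -- The factorization `a = (a ω₀(a)⁻¹) ω₀(a)` coming from idempotence of `ω 0`.
    refine ⟨⟨⟨a * (BiEndGroup.ω 0 a)⁻¹, ?_⟩, ⟨BiEndGroup.ω 0 a, a, rfl⟩⟩, ?_⟩
    · rw [MonoidHom.mem_ker, map_mul, map_inv, ω_ω, mul_inv_cancel]
    · change a * (BiEndGroup.ω 0 a)⁻¹ * BiEndGroup.ω 0 a = a
      rw [inv_mul_cancel_right]

end EssSurj

instance : toGBar.{u}.EssSurj where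
  mem_essImage A := ⟨ofGBar A, ⟨GBar.isoOfBijective (counitHom A) (counitHom_bijective A)⟩⟩

instance : toGBar.{u}.IsEquivalence where

end PreXMod

/-! ### Transport along isomorphisms and terminal split extensions. -/

section Transport

variable {A R : GBar.{u}}

/-- Actors can be transported along isomorphisms. -/
theorem IsActor.of_iso {act : R → A → A} {d : BiEndHom A R} (h : IsActor act d) {R' : GBar.{u}}
    (e : R' ≅ R) (d' : BiEndHom A R')
    (hd : ∀ a, BiEndHom.toMonoidHom e.hom (d' a) = d a) :
    IsActor (R := R') (fun r a => act (BiEndHom.toMonoidHom e.hom r) a) d' where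
  crossed :=
    { derived := (h.crossed.derived.isCompatibleAction.comp e.hom).isDerivedAction
      equivariant := fun r a => by
        rw [← GBar.hom_inv_apply e (d' _), hd, h.crossed.equivariant, ← hd, map_mul, map_mul,
          map_inv, GBar.hom_inv_apply, GBar.hom_inv_apply]
      peiffer := fun a a' => by rw [hd, h.crossed.peiffer] }
  universal C f hf := by
    obtain ⟨φ, hφ, huniq⟩ := h.universal C f hf
    refine ⟨(show C ⟶ R from φ) ≫ e.inv, fun c a => ?_, fun ψ hψ => ?_⟩
    · change _ = act (BiEndHom.toMonoidHom e.hom (BiEndHom.toMonoidHom e.inv (φ c))) a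
      rw [GBar.inv_hom_apply, hφ]
    · rw [← huniq ((show C ⟶ R' from ψ) ≫ e.hom) hψ]
      exact GBar.hom_ext fun c => (GBar.hom_inv_apply e (ψ c)).symm

/-- Split extensions can be transported along isomorphisms of the middle object. -/
theorem IsSplitExtension.of_iso {B E E' : GBar.{u}} {i : A ⟶ E} {p : E ⟶ B} {s : B ⟶ E}
    (h : IsSplitExtension i p s) (e : E' ≅ E) :
    IsSplitExtension (i ≫ e.inv) (e.hom ≫ p) (s ≫ e.inv) where
  injective a a' haa' := h.injective (by
    simpa only [GBar.comp_apply, GBar.inv_hom_apply] using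
      congrArg (BiEndHom.toMonoidHom e.hom) haa')
  exact x := by
    rw [GBar.comp_apply, h.exact]
    refine exists_congr fun a => ⟨fun ha => ?_, fun ha => ?_⟩
    · rw [GBar.comp_apply, ha, GBar.hom_inv_apply]
    · rw [← ha, GBar.comp_apply, GBar.inv_hom_apply]
  surjective b := ⟨BiEndHom.toMonoidHom (s ≫ e.inv) b, by
    rw [GBar.comp_apply, GBar.comp_apply, GBar.inv_hom_apply, h.section_eq]⟩
  section_eq b := by
    rw [GBar.comp_apply, GBar.comp_apply, GBar.inv_hom_apply, h.section_eq]

/-- Morphisms of split extensions with kernel `A` are induced by equivariant morphisms of the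
quotients. -/
theorem IsSplitExtension.exists_hom {B E E' : GBar.{u}} {i : BiEndHom A E} {s : BiEndHom R E}
    {p : BiEndHom E R} (h : IsSplitExtension i p s) {i' : BiEndHom A E'} {s' : BiEndHom B E'}
    {p' : BiEndHom E' B} (h' : IsSplitExtension i' p' s') {f : B → A → A}
    (hf : ∀ b a, i' (f b a) = s' b * i' a * (s' b)⁻¹) (φ : BiEndHom B R)
    (hφ : ∀ b a, i (f b a) = s (φ b) * i a * (s (φ b))⁻¹) :
    ∃ γ : BiEndHom E' E, (∀ a, γ (i' a) = i a) ∧ (∀ x, p (γ x) = φ (p' x)) ∧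
      ∀ b, γ (s' b) = s (φ b) := by
  -- The kernel coordinate `l x` in `x = i'(l x) s'(p' x)`; it is a crossed homomorphism, and `γ`
  -- replaces `i'`, `s'` by `i`, `s ∘ φ`.
  have key : ∀ x, ∃ a, i' a = x * (s' (p' x))⁻¹ := fun x => by
    rw [← h'.exact, map_mul, map_inv, h'.section_eq, mul_inv_cancel]
  choose l hl using key
  have hpi : ∀ a, p (i a) = 1 := fun a => (h.exact _).2 ⟨a, rfl⟩
  have hpi' : ∀ a, p' (i' a) = 1 := fun a => (h'.exact _).2 ⟨a, rfl⟩
  have hmul : ∀ x y, l (x * y) = l x * f (p' x) (l y) := fun x y => h'.injective <| by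
    rw [map_mul, hf, hl, hl, hl, map_mul, map_mul]; group
  have hω : ∀ j x, l (BiEndGroup.ω j x) = BiEndGroup.ω j (l x) := fun j x => h'.injective <| by
    simp only [BiEndGroup.hom_ω, hl, map_mul, map_inv]
  have hli : ∀ a, l (i' a) = a := fun a => h'.injective <| by
    rw [hl, hpi', map_one, inv_one, mul_one]
  have hls : ∀ b, l (s' b) = 1 := fun b => h'.injective <| by
    rw [hl, h'.section_eq, mul_inv_cancel, map_one]
  refine ⟨{ toMonoidHom := MonoidHom.mk' (fun x => i (l x) * s (φ (p' x))) fun x y => ?_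
            map_ω := fun j x => ?_ }, fun a => ?_, fun x => ?_, fun b => ?_⟩
  · rw [hmul, map_mul i.toMonoidHom, hφ, map_mul p'.toMonoidHom, map_mul φ.toMonoidHom, map_mul s.toMonoidHom]; group
  · change i (l _) * s (φ (p' _)) = BiEndGroup.ω j (i (l x) * s (φ (p' x)))
    simp only [hω, BiEndGroup.hom_ω, map_mul]
  · change i (l _) * s (φ (p' _)) = i a
    rw [hli, hpi', map_one, map_one, mul_one]
  · change p (i (l x) * s (φ (p' x))) = _
    rw [map_mul, hpi, h.section_eq, one_mul]
  · change i (l _) * s (φ (p' _)) = _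
    rw [hls, h'.section_eq, map_one, one_mul]

/-- A morphism out of a split extension is determined on the kernel and on the section. -/
theorem IsSplitExtension.hom_ext {B E E' : GBar.{u}} {i : BiEndHom A E} {p : BiEndHom E B}
    {s : BiEndHom B E} (h : IsSplitExtension i p s) {γ γ' : BiEndHom E E'}
    (hi : ∀ a, γ (i a) = γ' (i a)) (hs : ∀ b, γ (s b) = γ' (s b)) : γ = γ' := by
  refine BiEndHom.ext (funext fun x => ?_)
  change γ x = γ' x
  obtain ⟨a, ha⟩ := (h.exact (x * (s (p x))⁻¹)).1 (by
    rw [map_mul, map_inv, h.section_eq, mul_inv_cancel])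
  have hx : x = i a * s (p x) := by rw [ha, inv_mul_cancel_right]
  rw [hx, map_mul, map_mul, hi, hs]

/-- A split extension inducing the action of an actor is terminal among the split extensions with
the same kernel. -/
theorem IsActor.existsUnique_hom {act : R → A → A} {d : BiEndHom A R} (h : IsActor act d)
    {B E E' : GBar.{u}} {i : A ⟶ E} {p : E ⟶ R} {s : R ⟶ E} (hs : IsSplitExtension i p s)
    (hact : ∀ r a, BiEndHom.toMonoidHom i (act r a) =
      BiEndHom.toMonoidHom s r * BiEndHom.toMonoidHom i a * (BiEndHom.toMonoidHom s r)⁻¹)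
    {i' : A ⟶ E'} {p' : E' ⟶ B} {s' : B ⟶ E'} (hs' : IsSplitExtension i' p' s') :
    ∃! γφ : (E' ⟶ E) × (B ⟶ R), i' ≫ γφ.1 = i ∧ γφ.1 ≫ p = p' ≫ γφ.2 ∧ s' ≫ γφ.1 = γφ.2 ≫ s := by
  obtain ⟨f, hf⟩ := hs'.exists_action
  obtain ⟨φ, hφ, huniq⟩ := h.universal B f ⟨E', i', p', s', hs', hf⟩
  obtain ⟨γ, hγi, hγp, hγs⟩ := hs.exists_hom hs' hf φ fun b a => by rw [hφ, hact]
  refine ⟨(γ, φ), ⟨GBar.hom_ext hγi, GBar.hom_ext hγp, GBar.hom_ext hγs⟩, ?_⟩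
  rintro ⟨γ', φ'⟩ ⟨hi, -, hsec⟩
  replace hi := GBar.congr_hom hi
  replace hsec := GBar.congr_hom hsec
  simp only [GBar.comp_apply] at hi hsec
  -- Applying `γ'` to the conjugation formula in `E'` shows that `φ'` also classifies the action
  -- `f`.
  have hφ' : φ' = φ := huniq φ' fun b a => hs.injective <| by
    rw [hact, ← hsec, ← hi, ← hi, hf, map_mul, map_mul, map_inv]
  subst hφ'
  have hγ' : γ' = γ := hs'.hom_ext (fun a => (hi a).trans (hγi a).symm)
    fun b => (hsec b).trans (hγs b).symm
  rw [hγ']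

end Transport

/-! ### Actors and universal split extensions of precrossed modules. -/

namespace PreXMod

variable {X E B : PreXMod.{u}} {k : X ⟶ E} {p : E ⟶ B} {s : B ⟶ E}

theorem IsSplitExt.toGBar (h : IsSplitExt k p s) :
    IsSplitExtension (toGBar.map k) (toGBar.map p) (toGBar.map s) where
  injective x y hxy := SemidirectProduct.ext
    (h.injective_top (congrArg SemidirectProduct.left hxy))
    (h.injective_base (congrArg SemidirectProduct.right hxy))
  exact x := by
    constructor
    · intro hx
      have ht : x.left ∈ (Hom.top p).ker := congrArg SemidirectProduct.left hx
      have hb : x.right ∈ (Hom.base p).ker := congrArg SemidirectProduct.right hx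
      rw [h.exact_top] at ht
      rw [h.exact_base] at hb
      obtain ⟨t, ht⟩ := ht
      obtain ⟨g, hg⟩ := hb
      exact ⟨⟨t, g⟩, SemidirectProduct.ext ht hg⟩
    · rintro ⟨y, rfl⟩
      have ht : Hom.top k y.left ∈ (Hom.top p).ker := h.exact_top ▸ ⟨y.left, rfl⟩
      have hb : Hom.base k y.right ∈ (Hom.base p).ker := h.exact_base ▸ ⟨y.right, rfl⟩
      exact SemidirectProduct.ext ht hb
  surjective b := ⟨BiEndHom.toMonoidHom (PreXMod.toGBar.map s) b,
    GBar.congr_hom (congrArg PreXMod.toGBar.map h.section_eq) b⟩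
  section_eq b := GBar.congr_hom (congrArg PreXMod.toGBar.map h.section_eq) b

/-- Each condition on `T` or `G` is the one on semidirect products, tested on elements `(t, 1)` or
`(1, g)`. -/
theorem IsSplitExt.of_toGBar
    (h : IsSplitExtension (PreXMod.toGBar.map k) (PreXMod.toGBar.map p) (PreXMod.toGBar.map s)) :
    IsSplitExt k p s where
  injective_top t t' htt' := SemidirectProduct.inl_injective
    (h.injective (a₁ := SemidirectProduct.inl t) (a₂ := SemidirectProduct.inl t')
      (SemidirectProduct.ext htt' rfl))
  injective_base g g' hgg' := SemidirectProduct.inr_injective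
    (h.injective (a₁ := SemidirectProduct.inr g) (a₂ := SemidirectProduct.inr g')
      (SemidirectProduct.ext rfl hgg'))
  exact_top := by
    ext t
    constructor
    · intro ht
      obtain ⟨y, hy⟩ := (h.exact (SemidirectProduct.inl t)).1
        (SemidirectProduct.ext ht (map_one (Hom.base p)))
      exact ⟨y.left, congrArg SemidirectProduct.left hy⟩
    · rintro ⟨t, rfl⟩
      exact congrArg SemidirectProduct.left ((h.exact _).2 ⟨SemidirectProduct.inl t, rfl⟩)
  exact_base := by
    ext g
    constructor
    · intro hg
      obtain ⟨y, hy⟩ := (h.exact (SemidirectProduct.inr g)).1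
        (SemidirectProduct.ext (map_one (Hom.top p)) hg)
      exact ⟨y.right, congrArg SemidirectProduct.right hy⟩
    · rintro ⟨g, rfl⟩
      exact congrArg SemidirectProduct.right ((h.exact _).2 ⟨SemidirectProduct.inr g, rfl⟩)
  section_eq := PreXMod.toGBar.map_injective (GBar.hom_ext h.section_eq)

theorem IsUniversalSplitExt.of_isActor {R : PreXMod.{u}} {p : E ⟶ R} {s : R ⟶ E}
    {act : PreXMod.toGBar.obj R → PreXMod.toGBar.obj X → PreXMod.toGBar.obj X}
    {d : BiEndHom (PreXMod.toGBar.obj X) (PreXMod.toGBar.obj R)} (h : IsActor act d)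
    (hs : IsSplitExtension (PreXMod.toGBar.map k) (PreXMod.toGBar.map p) (PreXMod.toGBar.map s))
    (hact : ∀ r a, BiEndHom.toMonoidHom (PreXMod.toGBar.map k) (act r a) =
      BiEndHom.toMonoidHom (PreXMod.toGBar.map s) r *
        BiEndHom.toMonoidHom (PreXMod.toGBar.map k) a *
        (BiEndHom.toMonoidHom (PreXMod.toGBar.map s) r)⁻¹) :
    IsUniversalSplitExt k p s where
  split := .of_toGBar hs
  universal E' B k' p' s' hs' := by
    obtain ⟨⟨γ, φ⟩, ⟨h1, h2, h3⟩, huniq⟩ := h.existsUnique_hom hs hact hs'.toGBar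
    refine ⟨(PreXMod.toGBar.preimage γ, PreXMod.toGBar.preimage φ),
      ⟨PreXMod.toGBar.map_injective ?_, PreXMod.toGBar.map_injective ?_,
        PreXMod.toGBar.map_injective ?_⟩, ?_⟩
    · simpa using h1
    · simpa using h2
    · simpa using h3
    · rintro ⟨γ', φ'⟩ ⟨h1', h2', h3'⟩
      have := huniq (PreXMod.toGBar.map γ', PreXMod.toGBar.map φ')
        ⟨by rw [← Functor.map_comp, h1'], by rw [← Functor.map_comp, h2', Functor.map_comp],
          by rw [← Functor.map_comp, h3', Functor.map_comp]⟩
      rw [Prod.mk.injEq] at this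
      refine Prod.ext (PreXMod.toGBar.map_injective ?_) (PreXMod.toGBar.map_injective ?_)
      · simpa using this.1
      · simpa using this.2

theorem exists_actor (X : PreXMod.{u}) : ∃ R : PreXMod.{u},
    (∃ (act : PreXMod.toGBar.obj R → PreXMod.toGBar.obj X → PreXMod.toGBar.obj X)
      (d : X ⟶ R), IsActor act (PreXMod.toGBar.map d)) ∧
    ∃ (E : PreXMod.{u}) (k : X ⟶ E) (p : E ⟶ R) (s : R ⟶ E), IsUniversalSplitExt k p s := by
  let A := PreXMod.toGBar.obj X
  let e := PreXMod.toGBar.objObjPreimageIso (frakB A)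
  let δ : A ⟶ frakB A := (conj_isCompatibleAction A).toFrakB
  let d := PreXMod.toGBar.preimage (δ ≫ e.inv)
  have hA := (frakB_isActor A).of_iso e (PreXMod.toGBar.map d) fun a => by
    rw [Functor.map_preimage, GBar.comp_apply, GBar.inv_hom_apply]
  have hc := hA.crossed.derived.isCompatibleAction
  refine ⟨PreXMod.toGBar.objPreimage (frakB A), ⟨_, d, hA⟩, ?_⟩
  -- The universal extension is the semidirect product for the actor's action, pulled back through
  -- the equivalence.
  let ε := PreXMod.toGBar.objObjPreimageIso hc.semidirect
  refine ⟨_, PreXMod.toGBar.preimage ((show A ⟶ _ from hc.inl) ≫ ε.inv),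
    PreXMod.toGBar.preimage (ε.hom ≫ hc.proj),
    PreXMod.toGBar.preimage ((show _ ⟶ hc.semidirect from hc.inr) ≫ ε.inv),
    .of_isActor hA ?_ fun r a => ?_⟩
  · simp only [Functor.map_preimage]
    exact IsSplitExtension.of_iso hc.isSplitExtension ε
  · simp only [Functor.map_preimage, GBar.comp_apply]
    rw [hc.inl_act, map_mul, map_mul, map_inv]

end PreXMod

theorem mainTheorem10 :
    PreXMod.toGBar.{u}.IsEquivalence ∧
    (∀ A : GBar.{u}, ∃ h : PrecrossedIdentities (FrakB A),
      ∃ d : BiEndHom A (GBar.mk (FrakB A)),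
        (∀ (a : A) (w : List (Fin 2)) (a' : A),
          (d a).1 w a' = wordOp w a * a' * (wordOp w a)⁻¹) ∧
        IsActor (A := A) (R := GBar.mk (FrakB A)) (frakBAct A) d) ∧
    (∀ X : PreXMod.{u}, ∃ R : PreXMod.{u},
      (∃ (act : PreXMod.toGBar.obj R → PreXMod.toGBar.obj X → PreXMod.toGBar.obj X)
        (d : X ⟶ R), IsActor act (PreXMod.toGBar.map d)) ∧
      ∃ (E : PreXMod.{u}) (k : X ⟶ E) (p : E ⟶ R) (s : R ⟶ E),
        PreXMod.IsUniversalSplitExt k p s) := by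
  refine ⟨inferInstance, fun A => ⟨inferInstance, (conj_isCompatibleAction A).toFrakB,
    fun _ _ _ => rfl, frakB_isActor A⟩, PreXMod.exists_actor⟩
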